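/- **Setting.** A (normal) factored structure consists of finite non-empty state components $\mathcal S_1,\dots,\mathcal S_m$ with $|\mathcal S_i|=S_i$, finite non-empty action components $\mathcal A_1,\dots,\mathcal A_{n-m}$, and scopes $Z_1^P,\dots,Z_m^P\subseteq\{1,\dots,n\}$. The state space is $\mathcal S=\prod_{i}\mathcal S_i$, the action space is $\mathcal A=\prod_j\mathcal A_j$, and the components of the state-action space $\mathcal X=\mathcal S\times\mathcal A$ are $\mathcal X_i=\mathcal S_i$ for $i\le m$ and $\mathcal X_{m+j}=\mathcal A_j$. For $I\subseteq\{1,\dots,n\}$ let $x[I]=(x_i)_{i\in I}$, $\mathcal X[I]=\prod_{i\in I}\mathcal X_i$ and $X[I]=|\mathcal X[I]|$. An FMDP with this structure and horizon $H$ is given by a reward function $R:\mathcal S\times\mathcal A\to[0,1]$ (not necessarily factored) and transition probabilities $P(s'\mid s,a)=\prod_{i=1}^m P_i\bigl(s'[i]\mid x[Z_i^P]\bigr)$, where $x=(s,a)$ and each $P_i(\cdot\mid y)$, $y\in\mathcal X[Z_i^P]$, is a probability distribution on $\mathcal S_i$. For a policy $\pi$, which assigns to each step $h\in\{1,\dots,H\}$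 and each state a probability distribution on $\mathcal A$, let $V_1^\pi(s)$ be the expected sum of the rewards of the $H$ steps of an episode that starts in $s$ and follows $\pi$, and let $V_1^*(s)=\sup_\pi V_1^\pi(s)$. A learning algorithm with known rewards is given the reward function $R$, but not the transition probabilities, and chooses, possibly at random, a policy $\pi_k$ for each episode $k$, on the basis of the trajectories of the previous episodes and the initial state of episode $k$. For initial states $s_{1,1},\dots,s_{K,1}$, its regret over $K$ episodes is $\sum_{k=1}^K\bigl(V_1^*(s_{k,1})-V_1^{\pi_k}(s_{k,1})\bigr)$, and $T=KH$ is the total number of steps. **Theorem.** There is a universal constant $c>0$ such that the following holds. Consider a normal factored structure such that, for every $i\in\{1,\dots,m\}$, one has $S_i\ge 3$, $i\in Z_i^P$, and $Z_i^P$ contains the index of some action component with at least two elements. Let $H\ge 2$ and $K\ge\max_i X[Z_i^P]$. Then for every learning algorithm with known rewards there are an FMDP with this structure and horizon $H$, and initial states $s_{1,1},\dots,s_{K,1}$, for which the expected regret of the algorithm over $K$ episodes is at least $$c\,\max_{1\le i\le m}\sqrt{H\,X[Z_i^P]\,T}.$$ -/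

import Mathlib

universe u v

noncomputable section

namespace FactoredMDP

/-! ### Factored spaces

A normal factored structure has `m` state components `S i` and `p = n - m` action components `A j`.
The index set `[n]` of the state-action components is written `Fin m ⊕ Fin p`: the first `m`
indices are the state components and the remaining ones are the action components. -/

/-- The state space, the product of the state components. -/
abbrev State {m : ℕ} (S : Fin m → Type u) : Type u := ∀ i, S i

/-- The action space, the product of the action components. -/
abbrev Action {p : ℕ} (A : Fin p → Type u) : Type u := ∀ j, A j

/-- The components of the state-action space. -/
def Component {m p : ℕ} (S : Fin m → Type u) (A : Fin p → Type u) : Fin m ⊕ Fin p → Type u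
  | .inl i => S i
  | .inr j => A j

/-- The state-action pair `(s, a)`, read as a tuple of components. -/
def stateAction {m p : ℕ} {S : Fin m → Type u} {A : Fin p → Type u}
    (s : State S) (a : Action A) : ∀ z, Component S A z
  | .inl i => s i
  | .inr j => a j

/-- The scope space `X[I]`, the product of the state-action components with index in `I`. -/
abbrev ScopeSpace {m p : ℕ} (S : Fin m → Type u) (A : Fin p → Type u)
    (I : Finset (Fin m ⊕ Fin p)) : Type u :=
  ∀ z : {z // z ∈ I}, Component S A z.1

/-- The scope variable `x[I]` of the state-action pair `x = (s, a)`. -/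
def scopeVar {m p : ℕ} {S : Fin m → Type u} {A : Fin p → Type u}
    (I : Finset (Fin m ⊕ Fin p)) (s : State S) (a : Action A) : ScopeSpace S A I :=
  fun z => stateAction s a z.1

/-- The cardinality of the scope space `X[I]`. -/
def scopeSize {m p : ℕ} (S : Fin m → Type u) (A : Fin p → Type u)
    (I : Finset (Fin m ⊕ Fin p)) : ℕ :=
  Nat.card (ScopeSpace S A I)

/-- The largest size of the scope of a state component. -/
def maxScopeSize {m p : ℕ} (S : Fin m → Type u) (A : Fin p → Type u)
    (scope : Fin m → Finset (Fin m ⊕ Fin p)) : ℕ :=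
  Finset.univ.sup fun i => scopeSize S A (scope i)

/-! ### Factored Markov decision processes -/

/-- The unknowns of an FMDP whose transition has the scopes `scope`: a reward function with values
in `[0, 1]`, not necessarily factored, and for every state component `i` a transition kernel
from its scope space to the probability simplex on `S i`. -/
structure FMDP {m p : ℕ} (S : Fin m → Type u) (A : Fin p → Type u) [∀ i, Fintype (S i)]
    (scope : Fin m → Finset (Fin m ⊕ Fin p)) where
  reward : State S → Action A → ℝ
  reward_mem : ∀ s a, reward s a ∈ Set.Icc (0 : ℝ) 1
  transComp : ∀ i, ScopeSpace S A (scope i) → S i → ℝ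
  transComp_mem : ∀ i x, transComp i x ∈ stdSimplex ℝ (S i)

/-- A (stochastic, time-dependent) policy for episodes of length `H`: for every step and state a
probability distribution on the actions. -/
abbrev Policy {m p : ℕ} (S : Fin m → Type u) (A : Fin p → Type u) [∀ j, Fintype (A j)]
    (H : ℕ) : Type u :=
  Fin H → State S → stdSimplex ℝ (Action A)

/-- A trajectory of one episode: the states `s_1, …, s_{H+1}` and the actions `a_1, …, a_H`
(numbered from `0` in the code). -/
abbrev Trajectory {m p : ℕ} (S : Fin m → Type u) (A : Fin p → Type u) (H : ℕ) : Type u :=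
  (Fin (H + 1) → State S) × (Fin H → Action A)

section Dynamics

variable {m p : ℕ} {S : Fin m → Type u} {A : Fin p → Type u}
  [∀ i, Fintype (S i)] [∀ j, Fintype (A j)] {scope : Fin m → Finset (Fin m ⊕ Fin p)}

/-- The factored transition probability `P(s' | s, a) = ∏ i, P_i(s'[i] | x[scope i])`. -/
def FMDP.trans (M : FMDP S A scope) (s : State S) (a : Action A) (s' : State S) : ℝ :=
  ∏ i, M.transComp i (scopeVar (scope i) s a) (s' i)

open Classical in
/-- The probability of the trajectory `τ` in an episode that starts in `s` and follows `π`. -/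
def FMDP.trajProb (M : FMDP S A scope) {H : ℕ} (π : Policy S A H) (s : State S)
    (τ : Trajectory S A H) : ℝ :=
  (if τ.1 0 = s then 1 else 0) *
    ∏ h : Fin H, ((π h (τ.1 h.castSucc)).1 (τ.2 h) *
      M.trans (τ.1 h.castSucc) (τ.2 h) (τ.1 h.succ))

/-- The value `V_1^π(s)`: the expected sum of the rewards of an episode that starts in `s` and
follows `π`. -/
def FMDP.value (M : FMDP S A scope) {H : ℕ} (π : Policy S A H) (s : State S) : ℝ :=
  ∑ τ : Trajectory S A H,
    M.trajProb π s τ * ∑ h : Fin H, M.reward (τ.1 h.castSucc) (τ.2 h)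

/-- The optimal value `V_1^*(s)` for episodes of length `H`. -/
def FMDP.optValue (M : FMDP S A scope) (H : ℕ) (s : State S) : ℝ :=
  ⨆ π : Policy S A H, M.value π s

end Dynamics

/-! ### Learning algorithms and regret -/

/-- A learning algorithm for known rewards. It is given the reward function `R`, has an internal
random seed `ω`, and before each episode selects a policy, depending on `R`, the seed, the
trajectories of the `k` previous episodes and the initial state of the current episode. -/
structure Algorithm {m p : ℕ} (S : Fin m → Type u) (A : Fin p → Type u)
    [∀ j, Fintype (A j)] (H : ℕ) (Ω : Type v) [MeasurableSpace Ω] where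
  policy : (R : State S → Action A → ℝ) → (ω : Ω) → (k : ℕ) →
    (past : Fin k → Trajectory S A H) → (s : State S) → Policy S A H
  measurable_policy : ∀ R k past s h s' a,
    Measurable fun ω => (policy R ω k past s h s').1 a

section Regret

variable {m p : ℕ} {S : Fin m → Type u} {A : Fin p → Type u}
  [∀ i, Fintype (S i)] [∀ j, Fintype (A j)] {scope : Fin m → Finset (Fin m ⊕ Fin p)}
  {H : ℕ} {Ω : Type v} [MeasurableSpace Ω]

/-- The policy that the algorithm follows in episode `k`, when the seed is `ω`, the initial states
are `init` and the trajectories of the episodes are `τ`; only the trajectories before episode `k`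
are used. -/
def Algorithm.policyAt (alg : Algorithm S A H Ω) (R : State S → Action A → ℝ) (ω : Ω) {K : ℕ}
    (init : Fin K → State S) (τ : Fin K → Trajectory S A H) (k : Fin K) : Policy S A H :=
  alg.policy R ω k (fun j : Fin k => τ (Fin.castLE k.is_lt.le j)) (init k)

/-- The probability, given the seed `ω`, that the trajectories of `K` episodes are `τ`. -/
def runProb (M : FMDP S A scope) (alg : Algorithm S A H Ω) (ω : Ω) {K : ℕ}
    (init : Fin K → State S) (τ : Fin K → Trajectory S A H) : ℝ :=
  ∏ k : Fin K, M.trajProb (alg.policyAt M.reward ω init τ k) (init k) (τ k)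

/-- The regret `∑ k, (V_1^*(s_{k,1}) - V_1^{π_k}(s_{k,1}))` of a run over `K` episodes. -/
def regret (M : FMDP S A scope) (alg : Algorithm S A H Ω) (ω : Ω) {K : ℕ}
    (init : Fin K → State S) (τ : Fin K → Trajectory S A H) : ℝ :=
  ∑ k : Fin K, (M.optValue H (init k) - M.value (alg.policyAt M.reward ω init τ k) (init k))

/-- The expected regret over `K` episodes with initial states `init`. The expectation is over the
seed of the algorithm, with law `μ`, and over the trajectories. -/
def expectedRegret (M : FMDP S A scope) (alg : Algorithm S A H Ω) (μ : MeasureTheory.Measure Ω)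
    {K : ℕ} (init : Fin K → State S) : ℝ :=
  ∫ ω, ∑ τ : Fin K → Trajectory S A H, runProb M alg ω init τ * regret M alg ω init τ ∂μ

end Regret

end FactoredMDP

end

/-! The scope of one state component hides a contextual bandit. Take `i` with the largest scope: the
state components of the scope are the context, its action components the arm. All components but `i`
move to a fixed `d`. Component `i` jumps in the first step either to `d i`, which is absorbing and
pays 1 per step, or to the absorbing value `d'`, which pays 0. The first has probability `1/2`, or
`1/2 + ε` for the secret best arm `θ c` of the context `c`. The rewards do not depend on `θ`, so
knowing them does not help, and missing the best arm costs `(H - 1) ε`.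

Best arms are hard to find by the usual argument: compare the law of a run with that in which no arm
is special in the context `c` (`none`). Making `l` the best arm changes the law by a divergence of
order `ε²` times the expected number of plays of `l` (`Bandit.sum_runLaw_update_plays_le`, from
`sum_mul_likelihood_le` and the tower property). Under `none` the plays do not depend on `θ c`, so
on average over `θ c` the best arm receives only a fraction `1 / |Λ|` of the visits. If `ε²` times
the visits per context is a small multiple of `|Λ|`, some `θ` makes a quarter of the episodes miss
(`Bandit.exists_integral_misses_ge`).

Since `S i` has three elements, at least a third of the contexts are neither good nor bad. Starting
in these cyclically allows `ε` of order `√(X / K)`, hence regret of order `H ε K = H √(X K)`, which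
is `√(H X T)`. -/

noncomputable section

namespace FactoredMDP

/-! ### Tabular Markov decision processes -/

section Tabular

variable {σ α : Type u} [Fintype α]

open Classical in
/-- The probability of a trajectory under the transition kernel `T` and the policy `π`. -/
def pathProb (T : σ → α → σ → ℝ) {H : ℕ} (π : Fin H → σ → stdSimplex ℝ α) (s : σ)
    (τ : (Fin (H + 1) → σ) × (Fin H → α)) : ℝ :=
  (if τ.1 0 = s then 1 else 0) *
    ∏ h : Fin H, ((π h (τ.1 h.castSucc)).1 (τ.2 h) * T (τ.1 h.castSucc) (τ.2 h) (τ.1 h.succ))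

open Classical in
theorem pathProb_cons (T : σ → α → σ → ℝ) {H : ℕ} (π : Fin (H + 1) → σ → stdSimplex ℝ α)
    (s s₀ : σ) (a : α) (τ : (Fin (H + 1) → σ) × (Fin H → α)) :
    pathProb T π s (Fin.cons s₀ τ.1, Fin.cons a τ.2) =
      (if s₀ = s then 1 else 0) * ((π 0 s₀).1 a * T s₀ a (τ.1 0)) *
        pathProb T (fun h => π h.succ) (τ.1 0) τ := by
  simp only [pathProb, Fin.prod_univ_succ, Fin.cons_zero, Fin.cons_succ, Fin.castSucc_zero,
    Fin.castSucc_succ, if_true, one_mul]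
  ring

theorem pathProb_eq_zero (T : σ → α → σ → ℝ) {H : ℕ} (π : Fin H → σ → stdSimplex ℝ α)
    {s : σ} {τ : (Fin (H + 1) → σ) × (Fin H → α)} (h : τ.1 0 ≠ s) : pathProb T π s τ = 0 := by
  simp [pathProb, h]

theorem pathProb_nonneg {T : σ → α → σ → ℝ} (hT : ∀ s a s', 0 ≤ T s a s') {H : ℕ}
    (π : Fin H → σ → stdSimplex ℝ α) (s : σ) (τ : (Fin (H + 1) → σ) × (Fin H → α)) :
    0 ≤ pathProb T π s τ :=
  mul_nonneg (by split_ifs <;> norm_num)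
    (Finset.prod_nonneg fun h _ => mul_nonneg ((π h _).2.1 _) (hT _ _ _))

variable [Fintype σ]

/-- The expected total reward of an episode under the transition kernel `T`. -/
def pathValue (T : σ → α → σ → ℝ) (r : σ → α → ℝ) {H : ℕ} (π : Fin H → σ → stdSimplex ℝ α)
    (s : σ) : ℝ :=
  ∑ τ : (Fin (H + 1) → σ) × (Fin H → α),
    pathProb T π s τ * ∑ h : Fin H, r (τ.1 h.castSucc) (τ.2 h)

theorem sum_traj_succ {H : ℕ} (F : (Fin (H + 2) → σ) × (Fin (H + 1) → α) → ℝ) :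
    ∑ τ, F τ = ∑ s₀ : σ, ∑ a : α, ∑ τ : (Fin (H + 1) → σ) × (Fin H → α),
      F (Fin.cons s₀ τ.1, Fin.cons a τ.2) := by
  simp only [Fintype.sum_prod_type]
  rw [← (Fin.consEquiv (fun _ : Fin (H + 2) => σ)).sum_comp]
  simp_rw [← (Fin.consEquiv (fun _ : Fin (H + 1) => α)).sum_comp]
  simp only [Fintype.sum_prod_type]
  exact Finset.sum_congr rfl fun _ _ => Finset.sum_comm

/-- First-step decomposition of the expectation of a function of the trajectory. -/
theorem sum_pathProb_succ (T : σ → α → σ → ℝ) {H : ℕ} (π : Fin (H + 1) → σ → stdSimplex ℝ α)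
    (s : σ) (F : (Fin (H + 2) → σ) × (Fin (H + 1) → α) → ℝ) :
    ∑ τ, pathProb T π s τ * F τ = ∑ a, (π 0 s).1 a * ∑ s', T s a s' *
      ∑ τ, pathProb T (fun h => π h.succ) s' τ * F (Fin.cons s τ.1, Fin.cons a τ.2) := by
  classical
  rw [sum_traj_succ, Finset.sum_eq_single s (fun s₀ _ h => by simp [pathProb_cons, h]) (by simp)]
  refine Finset.sum_congr rfl fun a _ => ?_
  simp only [pathProb_cons, if_true, one_mul, Finset.mul_sum]
  rw [Finset.sum_comm]
  refine Finset.sum_congr rfl fun τ _ => ?_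
  rw [Finset.sum_eq_single (τ.1 0) (fun s' _ h => by simp [pathProb_eq_zero T _ h.symm]) (by simp)]
  ring

theorem sum_pathProb {T : σ → α → σ → ℝ} (hT : ∀ s a, ∑ s', T s a s' = 1) {H : ℕ}
    (π : Fin H → σ → stdSimplex ℝ α) (s : σ) : ∑ τ, pathProb T π s τ = 1 := by
  classical
  induction H generalizing s with
  | zero =>
    rw [← ((Equiv.funUnique (Fin 1) σ).symm.prodCongr (Equiv.refl (Fin 0 → α))).sum_comp]
    rw [Fintype.sum_prod_type]
    simp [pathProb]
  | succ H ih =>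
    have h := sum_pathProb_succ T π s (fun _ => 1)
    simp only [mul_one, ih, hT] at h
    rw [h]
    exact (π 0 s).2.2

theorem pathValue_succ {T : σ → α → σ → ℝ} (hT : ∀ s a, ∑ s', T s a s' = 1) (r : σ → α → ℝ)
    {H : ℕ} (π : Fin (H + 1) → σ → stdSimplex ℝ α) (s : σ) :
    pathValue T r π s = ∑ a, (π 0 s).1 a *
      (r s a + ∑ s', T s a s' * pathValue T r (fun h => π h.succ) s') := by
  rw [pathValue, sum_pathProb_succ]
  refine Finset.sum_congr rfl fun a _ => ?_
  congr 1
  simp only [Fin.sum_univ_succ, Fin.castSucc_zero, Fin.cons_zero, Fin.castSucc_succ, Fin.cons_succ,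
    mul_add, Finset.sum_add_distrib, ← Finset.sum_mul, sum_pathProb hT, hT, one_mul]
  rfl

/-- The transition kernel that moves from `s` to `G` with probability `q s a` and to `B`
otherwise. -/
def twoPoint [DecidableEq σ] (G B : σ) (q : σ → α → ℝ) (s : σ) (a : α) (s' : σ) : ℝ :=
  q s a * (if s' = G then 1 else 0) + (1 - q s a) * (if s' = B then 1 else 0)

variable [DecidableEq σ] {G B : σ} {q q' : σ → α → ℝ}

omit [Fintype α] in
theorem sum_twoPoint_mul (s : σ) (a : α) (f : σ → ℝ) :
    ∑ s', twoPoint G B q s a s' * f s' = q s a * f G + (1 - q s a) * f B := by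
  simp [twoPoint, add_mul, Finset.sum_add_distrib]

omit [Fintype α] in
theorem sum_twoPoint (s : σ) (a : α) : ∑ s', twoPoint G B q s a s' = 1 := by
  simpa using sum_twoPoint_mul (G := G) (B := B) (q := q) s a (fun _ => 1)

omit [Fintype σ] [Fintype α] in
theorem twoPoint_nonneg (hq : ∀ s a, q s a ∈ Set.Icc (0 : ℝ) 1) (s : σ) (a : α) (s' : σ) :
    0 ≤ twoPoint G B q s a s' := by
  have h := hq s a
  exact add_nonneg (mul_nonneg h.1 (by split_ifs <;> norm_num))
    (mul_nonneg (sub_nonneg.2 h.2) (by split_ifs <;> norm_num))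

theorem pathValue_twoPoint_good {r : σ → α → ℝ} (hr : ∀ a, r G a = 1) (hq : ∀ a, q G a = 1)
    {H : ℕ} (π : Fin H → σ → stdSimplex ℝ α) : pathValue (twoPoint G B q) r π G = H := by
  induction H with
  | zero => simp [pathValue]
  | succ H ih =>
    simp only [pathValue_succ sum_twoPoint, sum_twoPoint_mul, hr, hq, ih, ← Finset.sum_mul]
    rw [(π 0 G).2.2]
    push_cast
    ring

theorem pathValue_twoPoint_bad {r : σ → α → ℝ} (hr : ∀ a, r B a = 0) (hq : ∀ a, q B a = 0)
    {H : ℕ} (π : Fin H → σ → stdSimplex ℝ α) : pathValue (twoPoint G B q) r π B = 0 := by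
  induction H with
  | zero => simp [pathValue]
  | succ H ih => simp [pathValue_succ sum_twoPoint, sum_twoPoint_mul, hr, hq, ih]

/-- The first step pays nothing and decides everything: each of the `H` remaining steps pays 1 in
`G` and 0 in `B`. -/
theorem pathValue_twoPoint {r : σ → α → ℝ} (hrG : ∀ a, r G a = 1) (hqG : ∀ a, q G a = 1)
    (hrB : ∀ a, r B a = 0) (hqB : ∀ a, q B a = 0) {s : σ} (hrs : ∀ a, r s a = 0)
    {H : ℕ} (π : Fin (H + 1) → σ → stdSimplex ℝ α) :
    pathValue (twoPoint G B q) r π s = H * ∑ a, (π 0 s).1 a * q s a := by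
  simp only [pathValue_succ sum_twoPoint, sum_twoPoint_mul, hrs,
    pathValue_twoPoint_good hrG hqG, pathValue_twoPoint_bad hrB hqB, Finset.mul_sum]
  exact Finset.sum_congr rfl fun _ _ => by ring

omit [Fintype σ] in
/-- Kernels that agree in the two target states give the same law of the trajectories from there. -/
theorem pathProb_twoPoint_congr (hG : ∀ a, q' G a = q G a) (hB : ∀ a, q' B a = q B a) {H : ℕ}
    (π : Fin H → σ → stdSimplex ℝ α) {s : σ} (hs : s = G ∨ s = B)
    (τ : (Fin (H + 1) → σ) × (Fin H → α)) :
    pathProb (twoPoint G B q') π s τ = pathProb (twoPoint G B q) π s τ := by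
  induction H generalizing s with
  | zero => simp [pathProb]
  | succ H ih =>
    have e : τ = (Fin.cons (τ.1 0) (Fin.tail τ.1), Fin.cons (τ.2 0) (Fin.tail τ.2)) := by simp
    rw [e, pathProb_cons (τ := (Fin.tail τ.1, Fin.tail τ.2)),
      pathProb_cons (τ := (Fin.tail τ.1, Fin.tail τ.2))]
    by_cases h0 : τ.1 0 = s
    · have hT : ∀ s', twoPoint G B q' s (τ.2 0) s' = twoPoint G B q s (τ.2 0) s' := by
        rcases hs with rfl | rfl <;> intro s' <;> simp [twoPoint, hG, hB]
      by_cases h1 : Fin.tail τ.1 0 = G ∨ Fin.tail τ.1 0 = B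
      · simp only [h0, hT, ih _ h1]
      · push Not at h1
        simp [twoPoint, h1]
    · simp [h0]

omit [Fintype σ] in
-- Only the first step of an episode carries information: it ends in `G` or `B`, after which both
-- kernels give the same law. So the likelihood ratio of a trajectory is that of its first
-- transition.
theorem pathProb_twoPoint_mul (hG : ∀ a, q' G a = q G a) (hB : ∀ a, q' B a = q B a) {s : σ}
    {w : α → σ → ℝ}
    (hw : ∀ a s', twoPoint G B q' s a s' = twoPoint G B q s a s' * w a s') {H : ℕ}
    (π : Fin (H + 1) → σ → stdSimplex ℝ α) (τ : (Fin (H + 2) → σ) × (Fin (H + 1) → α)) :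
    pathProb (twoPoint G B q') π s τ =
      pathProb (twoPoint G B q) π s τ * w (τ.2 0) (τ.1 1) := by
  have e : τ = (Fin.cons (τ.1 0) (Fin.tail τ.1), Fin.cons (τ.2 0) (Fin.tail τ.2)) := by simp
  have e1 : τ.1 1 = Fin.tail τ.1 0 := rfl
  rw [e1]
  conv_lhs => rw [e, pathProb_cons (τ := (Fin.tail τ.1, Fin.tail τ.2))]
  conv_rhs => lhs; rw [e, pathProb_cons (τ := (Fin.tail τ.1, Fin.tail τ.2))]
  by_cases h0 : τ.1 0 = s
  · by_cases h1 : Fin.tail τ.1 0 = G ∨ Fin.tail τ.1 0 = B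
    · simp only [h0, hw, pathProb_twoPoint_congr hG hB _ h1]
      ring
    · push Not at h1
      simp [twoPoint, h1]
  · simp [h0]

theorem sum_pathProb_twoPoint_firstStep {H : ℕ} (π : Fin (H + 1) → σ → stdSimplex ℝ α) (s : σ)
    (f : α → σ → ℝ) :
    ∑ τ, pathProb (twoPoint G B q) π s τ * f (τ.2 0) (τ.1 1) =
      ∑ a, (π 0 s).1 a * (q s a * f a G + (1 - q s a) * f a B) := by
  rw [sum_pathProb_succ]
  refine Finset.sum_congr rfl fun a _ => ?_
  rw [← sum_twoPoint_mul]
  congr 1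
  refine Finset.sum_congr rfl fun s' _ => ?_
  congr 1
  calc _ = ∑ τ, pathProb (twoPoint G B q) (fun h => π h.succ) s' τ * f a s' := by
        refine Finset.sum_congr rfl fun τ _ => ?_
        by_cases h : τ.1 0 = s'
        · rw [← h]; rfl
        · simp [pathProb_eq_zero _ _ h]
    _ = f a s' := by rw [← Finset.sum_mul, sum_pathProb sum_twoPoint, one_mul]

end Tabular

/-! ### Sequential experiments -/

section Sequential

variable {X : Type u}

/-- The probability of a sequence of observations, when `p k past` is the law of observation `k`
given the earlier ones. -/
def seqProb (p : ∀ k : ℕ, (Fin k → X) → X → ℝ) {K : ℕ} (τ : Fin K → X) : ℝ :=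
  ∏ k : Fin K, p k (fun j => τ (Fin.castLE k.is_lt.le j)) (τ k)

theorem seqProb_snoc (p : ∀ k : ℕ, (Fin k → X) → X → ℝ) {K : ℕ} (τ : Fin K → X) (x : X) :
    seqProb p (Fin.snoc τ x : Fin (K + 1) → X) = seqProb p τ * p K τ x := by
  have h : ∀ (k : ℕ) (hk : k ≤ K) (j : Fin k),
      (Fin.snoc τ x : Fin (K + 1) → X) (Fin.castLE (hk.trans K.le_succ) j) =
        τ (Fin.castLE hk j) := fun k hk j =>
    Fin.snoc_castSucc (α := fun _ => X) x τ (Fin.castLE hk j)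
  rw [seqProb, Fin.prod_univ_castSucc]
  simp only [Fin.snoc_castSucc, Fin.snoc_last]
  congr 1
  · refine Finset.prod_congr rfl fun k _ => ?_
    congr 1
    funext j
    exact h k k.is_lt.le j
  · congr 1
    funext j
    exact h K le_rfl j

theorem seqProb_nonneg {p : ∀ k : ℕ, (Fin k → X) → X → ℝ} (hp : ∀ k past x, 0 ≤ p k past x) {K : ℕ} (τ : Fin K → X) :
    0 ≤ seqProb p τ :=
  Finset.prod_nonneg fun _ _ => hp _ _ _

variable [Fintype X]

theorem sum_seqProb_succ (p : ∀ k : ℕ, (Fin k → X) → X → ℝ) {K : ℕ}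
    (F : (Fin (K + 1) → X) → ℝ) :
    ∑ τ, seqProb p τ * F τ =
      ∑ τ : Fin K → X, seqProb p τ * ∑ x, p K τ x * F (Fin.snoc τ x) := by
  rw [← (Fin.snocEquiv (fun _ : Fin (K + 1) => X)).sum_comp, Fintype.sum_prod_type_right]
  refine Finset.sum_congr rfl fun τ _ => ?_
  rw [Finset.mul_sum]
  refine Finset.sum_congr rfl fun x _ => ?_
  rw [← mul_assoc, ← seqProb_snoc]
  rfl

variable {p : ∀ k : ℕ, (Fin k → X) → X → ℝ}

theorem sum_seqProb (hp : ∀ k past, ∑ x, p k past x = 1) (K : ℕ) :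
    ∑ τ : Fin K → X, seqProb p τ = 1 := by
  induction K with
  | zero => simp [seqProb]
  | succ K ih =>
    have h := sum_seqProb_succ p (K := K) (fun _ => 1)
    simpa only [mul_one, hp, ih] using h

/-- The tower property: an observation may be averaged given the earlier ones. -/
theorem sum_seqProb_tower (hp : ∀ k past, ∑ x, p k past x = 1) {K : ℕ} (k : Fin K) (f : X → ℝ) :
    ∑ τ, seqProb p τ * f (τ k) =
      ∑ τ, seqProb p τ * ∑ x, p k (fun j => τ (Fin.castLE k.is_lt.le j)) x * f x := by
  induction K with
  | zero => exact k.elim0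
  | succ K ih =>
    -- Split off the last observation. If it is observation `k`, its conditional mean appears at
    -- once; otherwise it sums to 1.
    rw [sum_seqProb_succ, sum_seqProb_succ]
    induction k using Fin.lastCases with
    | last =>
      refine Finset.sum_congr rfl fun τ _ => ?_
      have h' : ∀ x : X, (fun j : Fin ((Fin.last K : Fin (K + 1)) : ℕ) =>
          (Fin.snoc τ x : Fin (K + 1) → X) (Fin.castLE (Fin.last K).is_lt.le j)) = τ :=
        fun x => funext fun j => Fin.snoc_castSucc (α := fun _ => X) x τ j
      simp only [h', Fin.snoc_last, ← Finset.sum_mul]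
      rw [hp, one_mul]
      rfl
    | cast k =>
      have h : ∀ (τ : Fin K → X) (x : X), (fun j : Fin (k.castSucc : ℕ) =>
          (Fin.snoc τ x : Fin (K + 1) → X) (Fin.castLE k.castSucc.is_lt.le j)) =
            fun j : Fin (k : ℕ) => τ (Fin.castLE k.is_lt.le j) := fun τ x =>
        funext fun j => Fin.snoc_castSucc (α := fun _ => X) x τ (Fin.castLE k.is_lt.le j)
      simp only [h, Fin.snoc_castSucc, ← Finset.sum_mul, hp, one_mul]
      exact ih k

/-- A change of measure: the expectations of `f` under the laws `P` and `P * W` differ by at most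
a multiple of the Hellinger distance, which the Kullback-Leibler divergence bounds. -/
theorem sum_mul_likelihood_le {Y : Type u} [Fintype Y] {P W f : Y → ℝ} {b η : ℝ} (hη : 0 < η)
    (hP : ∀ y, 0 ≤ P y) (hP1 : ∑ y, P y = 1) (hW : ∀ y, 0 < W y) (hW1 : ∑ y, P y * W y = 1)
    (hf : ∀ y, f y ∈ Set.Icc 0 b) :
    ∑ y, P y * W y * f y ≤
      ∑ y, P y * f y + b * (η + (-∑ y, P y * Real.log (W y)) / η) := by
  have key : ∀ y, P y * W y * f y ≤ P y * f y +
      b * (η / 2 * (P y * W y + P y) + (P y * W y - P y - P y * Real.log (W y)) / η) := by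
    intro y
    set w := √(W y) with hw
    have hw0 : 0 < w := Real.sqrt_pos.2 (hW y)
    have hww : W y = w ^ 2 := (Real.sq_sqrt (hW y).le).symm
    have hlog : Real.log (W y) ≤ 2 * (w - 1) := by
      rw [hww, Real.log_pow]
      have := Real.log_le_sub_one_of_pos hw0
      push_cast
      linarith
    have hq : (w - 1) ^ 2 ≤ W y - 1 - Real.log (W y) := by nlinarith
    have h2 : (w - 1) ^ 2 / η ≤ (W y - 1 - Real.log (W y)) / η := by gcongr
    -- Young's inequality for `W y - 1 = (w - 1) (w + 1)`. It keeps the bound linear in the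
    -- divergence, so that it can be averaged over `θ` without a square root.
    have h3 : W y - 1 ≤ η / 2 * (W y + 1) + (w - 1) ^ 2 / η := by
      have h4 : η / 2 * (W y + 1) + (w - 1) ^ 2 / η - (W y - 1) =
          (((w - 1) - η / 2 * (w + 1)) ^ 2 + (η / 2 * (w - 1)) ^ 2) / η := by
        rw [hww]
        field_simp
        ring
      have : 0 ≤ (((w - 1) - η / 2 * (w + 1)) ^ 2 + (η / 2 * (w - 1)) ^ 2) / η := by positivity
      linarith
    set z := η / 2 * (W y + 1) + (W y - 1 - Real.log (W y)) / η with hz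
    have hz0 : 0 ≤ z := by
      have : 0 ≤ (w - 1) ^ 2 / η := by positivity
      have := mul_pos hη (hW y)
      linarith
    have hfz : (W y - 1) * f y ≤ b * z :=
      calc (W y - 1) * f y ≤ z * f y := mul_le_mul_of_nonneg_right (by linarith) (hf y).1
        _ ≤ z * b := mul_le_mul_of_nonneg_left (hf y).2 hz0
        _ = b * z := mul_comm _ _
    have h5 := mul_le_mul_of_nonneg_left hfz (hP y)
    have h6 : b * (η / 2 * (P y * W y + P y) + (P y * W y - P y - P y * Real.log (W y)) / η) =
        P y * (b * z) := by
      rw [hz]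
      ring
    linarith
  refine (Finset.sum_le_sum fun y _ => key y).trans_eq ?_
  rw [Finset.sum_add_distrib, ← Finset.mul_sum, Finset.sum_add_distrib, ← Finset.mul_sum,
    ← Finset.sum_div, Finset.sum_add_distrib, Finset.sum_sub_distrib, Finset.sum_sub_distrib,
    hP1, hW1]
  ring

end Sequential

/-! ### Contextual bandits as episodic decision processes -/

/-- A contextual bandit, played in the first step of an episode. In a context that is neither good
nor bad, an arm leads to the state `G` with probability `1 / 2`, or `1 / 2 + ε` if it is the best
one; otherwise it leads to `B`. Then the episode stays in `G` or in `B`. -/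
structure Bandit (σ α Γ Λ : Type u) where
  ctx : σ → Γ
  arm : α → Λ
  good : Γ → Prop
  bad : Γ → Prop
  G : σ
  B : σ
  ε : ℝ
  good_G : good (ctx G)
  bad_B : bad (ctx B)
  not_good_B : ¬ good (ctx B)
  eps_pos : 0 < ε
  four_eps_le : 4 * ε ≤ 1

namespace Bandit

variable {σ α Γ Λ : Type u} (b : Bandit σ α Γ Λ)

theorem G_ne_B : b.G ≠ b.B := fun h => b.not_good_B (h ▸ b.good_G)

open Classical in
/-- The probability of `G` after playing an arm in a context, when `θ` gives the best arms. -/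
def succProb (θ : Γ → Option Λ) (c : Γ) (l : Λ) : ℝ :=
  if b.good c then 1 else if b.bad c then 0 else if θ c = some l then 1 / 2 + b.ε else 1 / 2

theorem succProb_mem (θ : Γ → Option Λ) (c : Γ) (l : Λ) :
    b.succProb θ c l ∈ Set.Icc (0 : ℝ) 1 := by
  have h1 := b.eps_pos
  have h2 := b.four_eps_le
  unfold succProb
  split_ifs <;> constructor <;> linarith

theorem succProb_of_good (θ : Γ → Option Λ) {c : Γ} (hc : b.good c) (l : Λ) :
    b.succProb θ c l = 1 := by simp [succProb, hc]

theorem succProb_of_bad (θ : Γ → Option Λ) {c : Γ} (hc : ¬ b.good c) (hc' : b.bad c) (l : Λ) :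
    b.succProb θ c l = 0 := by simp [succProb, hc, hc']

open Classical in
/-- The transition kernel of the bandit with best arms `θ`. -/
def kernel (θ : Γ → Option Λ) : σ → α → σ → ℝ :=
  twoPoint b.G b.B fun s a => b.succProb θ (b.ctx s) (b.arm a)

section Law

variable [Fintype σ] [Fintype α]

open Classical in
/-- The probability that an arm is played under a distribution on the actions. -/
def armMass (ν : stdSimplex ℝ α) (l : Λ) : ℝ := ∑ a, ν.1 a * if b.arm a = l then 1 else 0

omit [Fintype σ] in
theorem sum_armMass [Fintype Λ] (ν : stdSimplex ℝ α) : ∑ l, b.armMass ν l = 1 := by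
  classical
  simp only [armMass]
  rw [Finset.sum_comm]
  simpa using ν.2.2

omit [Fintype σ] in
theorem armMass_nonneg (ν : stdSimplex ℝ α) (l : Λ) : 0 ≤ b.armMass ν l :=
  Finset.sum_nonneg fun a _ => mul_nonneg (ν.2.1 a) (by split_ifs <;> norm_num)

omit [Fintype σ] in
theorem armMass_le_one (ν : stdSimplex ℝ α) (l : Λ) : b.armMass ν l ≤ 1 := by
  refine (Finset.sum_le_sum fun a _ => ?_).trans_eq ν.2.2
  exact mul_le_of_le_one_right (ν.2.1 a) (by split_ifs <;> norm_num)

omit [Fintype α] in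
theorem sum_kernel (θ : Γ → Option Λ) (s : σ) (a : α) : ∑ s', b.kernel θ s a s' = 1 := by
  classical
  exact sum_twoPoint s a

omit [Fintype σ] [Fintype α] in
theorem kernel_nonneg (θ : Γ → Option Λ) (s : σ) (a : α) (s' : σ) : 0 ≤ b.kernel θ s a s' := by
  classical
  exact twoPoint_nonneg (fun _ _ => b.succProb_mem _ _ _) s a s'

/-- The value of a policy in a context with a best arm. -/
theorem pathValue_kernel {r : σ → α → ℝ} (hG : ∀ a, r b.G a = 1) (hB : ∀ a, r b.B a = 0) {s : σ}
    (hs : ∀ a, r s a = 0) (hg : ¬ b.good (b.ctx s)) (hb : ¬ b.bad (b.ctx s)) (θ : Γ → Λ) {H : ℕ}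
    (π : Fin (H + 1) → σ → stdSimplex ℝ α) :
    pathValue (b.kernel fun c => some (θ c)) r π s =
      H * (1 / 2 + b.ε * b.armMass (π 0 s) (θ (b.ctx s))) := by
  classical
  rw [kernel, pathValue_twoPoint hG (fun a => b.succProb_of_good _ b.good_G _) hB
    (fun a => b.succProb_of_bad _ b.not_good_B b.bad_B _) hs]
  congr 1
  have h := (π 0 s).2.2
  calc _ = ∑ a, ((π 0 s).1 a * (1 / 2) +
        b.ε * ((π 0 s).1 a * if b.arm a = θ (b.ctx s) then 1 else 0)) := by
        refine Finset.sum_congr rfl fun a _ => ?_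
        simp only [succProb, hg, hb, if_false, Option.some.injEq, eq_comm (a := θ (b.ctx s))]
        split_ifs <;> ring
    _ = _ := by rw [Finset.sum_add_distrib, ← Finset.mul_sum, ← Finset.sum_mul, h, armMass, one_mul]

open Classical in
/-- The likelihood ratio of an arm and its outcome in the context `c`, when `l` becomes the best
arm there. -/
def ratio (c : Γ) (l : Λ) (s : σ) (a : α) (s' : σ) : ℝ :=
  if b.ctx s = c ∧ b.arm a = l then if s' = b.G then 1 + 2 * b.ε else 1 - 2 * b.ε else 1

omit [Fintype σ] [Fintype α] in
theorem ratio_pos (c : Γ) (l : Λ) (s : σ) (a : α) (s' : σ) : 0 < b.ratio c l s a s' := by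
  have h1 := b.eps_pos
  have h2 := b.four_eps_le
  unfold ratio
  split_ifs <;> linarith

omit [Fintype σ] [Fintype α] in
-- In the context `c` all arms are fair under `θ`, and `1/2 ± ε = 1/2 * (1 ± 2 ε)`.
theorem kernel_update [DecidableEq Γ] {θ : Γ → Option Λ} {c : Γ} (hθ : θ c = none) (hg : ¬ b.good c)
    (hb : ¬ b.bad c) (l : Λ) (s : σ) (a : α) (s' : σ) :
    b.kernel (Function.update θ c (some l)) s a s' =
      b.kernel θ s a s' * b.ratio c l s a s' := by
  have hGB := b.G_ne_B
  by_cases hs : b.ctx s = c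
  · by_cases ha : b.arm a = l
    · subst ha
      simp only [kernel, twoPoint, succProb, ratio, hs, hg, hb, if_false, hθ, Function.update_self,
        true_and, if_true, reduceCtorEq]
      by_cases h1 : s' = b.G
      · subst h1
        simp only [if_true, hGB, if_false]
        ring
      · simp only [h1, if_false]
        ring
    · simp [kernel, twoPoint, succProb, ratio, hs, hg, hb, hθ, ha, Ne.symm ha]
  · have e : b.succProb (Function.update θ c (some l)) (b.ctx s) (b.arm a) =
        b.succProb θ (b.ctx s) (b.arm a) := by
      unfold succProb
      rw [Function.update_of_ne hs]
    simp [kernel, twoPoint, e, ratio, hs]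

omit [Fintype σ] in
theorem pathProb_update [DecidableEq Γ] {θ : Γ → Option Λ} {c : Γ} (hθ : θ c = none)
    (hg : ¬ b.good c) (hb : ¬ b.bad c) (l : Λ) {H : ℕ} (π : Fin (H + 1) → σ → stdSimplex ℝ α)
    (s : σ) (τ : (Fin (H + 2) → σ) × (Fin (H + 1) → α)) :
    pathProb (b.kernel (Function.update θ c (some l))) π s τ =
      pathProb (b.kernel θ) π s τ * b.ratio c l s (τ.2 0) (τ.1 1) := by
  classical
  refine pathProb_twoPoint_mul (fun a => ?_) (fun a => ?_) (fun a s' => ?_) π τ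
  · rw [b.succProb_of_good _ b.good_G, b.succProb_of_good _ b.good_G]
  · rw [b.succProb_of_bad _ b.not_good_B b.bad_B, b.succProb_of_bad _ b.not_good_B b.bad_B]
  · exact b.kernel_update hθ hg hb l s a s'

/-- The divergence between fair coin tosses and tosses with bias `ε`. -/
def divergence : ℝ := -(1 / 2 * (Real.log (1 + 2 * b.ε) + Real.log (1 - 2 * b.ε)))

omit [Fintype σ] [Fintype α] in
-- The divergence is `-log (1 - 4 ε²) / 2`; apply `log x ≥ 1 - 1 / x`, and `1 / (1 - y) ≤ 1 + 2 y`
-- for `y = 4 ε² ≤ 1/2`.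
theorem divergence_le : b.divergence ≤ 4 * b.ε ^ 2 := by
  have h1 := b.eps_pos
  have h2 := b.four_eps_le
  have h3 : 0 < 1 - 4 * b.ε ^ 2 := by nlinarith
  have h4 : 1 / 2 ≤ 1 - 4 * b.ε ^ 2 := by nlinarith
  have h5 := Real.one_sub_inv_le_log_of_pos h3
  have h6 : (1 - 4 * b.ε ^ 2)⁻¹ ≤ 1 + 8 * b.ε ^ 2 := by
    rw [inv_le_iff_one_le_mul₀ h3]
    nlinarith [sq_nonneg b.ε]
  have h7 : Real.log (1 + 2 * b.ε) + Real.log (1 - 2 * b.ε) = Real.log (1 - 4 * b.ε ^ 2) := by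
    rw [← Real.log_mul (by linarith) (by linarith)]
    congr 1
    ring
  rw [divergence, h7]
  linarith

open Classical in
-- The ratio differs from 1 only when `l` is played in the context `c`. There the toss is fair under
-- `θ`, so each such play contributes `-divergence` on average.
theorem sum_pathProb_log_ratio {θ : Γ → Option Λ} {c : Γ} (hθ : θ c = none) (hg : ¬ b.good c)
    (hb : ¬ b.bad c) (l : Λ) {H : ℕ} (π : Fin (H + 1) → σ → stdSimplex ℝ α) (s : σ) :
    ∑ τ, pathProb (b.kernel θ) π s τ * Real.log (b.ratio c l s (τ.2 0) (τ.1 1)) =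
      -b.divergence * if b.ctx s = c then b.armMass (π 0 s) l else 0 := by
  have h := sum_pathProb_twoPoint_firstStep (G := b.G) (B := b.B)
    (q := fun s a => b.succProb θ (b.ctx s) (b.arm a)) π s
    (fun a s' => Real.log (b.ratio c l s a s'))
  rw [kernel, h]
  by_cases hs : b.ctx s = c
  · rw [if_pos hs, armMass, Finset.mul_sum]
    refine Finset.sum_congr rfl fun a _ => ?_
    simp only [succProb, hs, hg, hb, hθ, if_false, reduceCtorEq, ratio, divergence, if_true,
      true_and, b.G_ne_B.symm]
    split_ifs
    · ring
    · simp
  · simp [ratio, hs]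

end Law

/-! ### Learning in a bandit -/

section Learning

variable [Fintype σ] [Fintype α] {H : ℕ}
  (pol : ∀ k : ℕ, (Fin k → (Fin (H + 2) → σ) × (Fin (H + 1) → α)) →
    Fin (H + 1) → σ → stdSimplex ℝ α) (init : ℕ → σ)

/-- The law of the trajectories of the episodes under a learner. -/
def runLaw (θ : Γ → Option Λ) {K : ℕ} (τ : Fin K → (Fin (H + 2) → σ) × (Fin (H + 1) → α)) : ℝ :=
  seqProb (fun k past => pathProb (b.kernel θ) (pol k past) (init k)) τ

omit [Fintype σ] in
theorem runLaw_nonneg (θ : Γ → Option Λ) {K : ℕ}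
    (τ : Fin K → (Fin (H + 2) → σ) × (Fin (H + 1) → α)) : 0 ≤ b.runLaw pol init θ τ :=
  seqProb_nonneg (fun _ _ _ => pathProb_nonneg (b.kernel_nonneg θ) _ _ _) τ

theorem sum_runLaw (θ : Γ → Option Λ) (K : ℕ) :
    ∑ τ : Fin K → (Fin (H + 2) → σ) × (Fin (H + 1) → α), b.runLaw pol init θ τ = 1 :=
  sum_seqProb (fun _ _ => sum_pathProb (b.sum_kernel θ) _ _) K

/-- The probability, given the previous episodes, that the arm `l` is played in episode `k`. -/
def playProb {K : ℕ} (τ : Fin K → (Fin (H + 2) → σ) × (Fin (H + 1) → α)) (k : Fin K) (l : Λ) : ℝ :=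
  b.armMass (pol k (fun j => τ (Fin.castLE k.is_lt.le j)) 0 (init k)) l

open Classical in
/-- The number of episodes in the context `c`. -/
def visits (K : ℕ) (c : Γ) : ℝ := ∑ k : Fin K, if b.ctx (init k) = c then 1 else 0

open Classical in
/-- The number of times that the arm `l` is expected to be played in the context `c`. -/
def plays {K : ℕ} (c : Γ) (l : Λ) (τ : Fin K → (Fin (H + 2) → σ) × (Fin (H + 1) → α)) : ℝ :=
  ∑ k : Fin K, if b.ctx (init k) = c then b.playProb pol init τ k l else 0

omit [Fintype σ] in
theorem plays_mem {K : ℕ} (c : Γ) (l : Λ) (τ : Fin K → (Fin (H + 2) → σ) × (Fin (H + 1) → α)) :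
    b.plays pol init c l τ ∈ Set.Icc 0 (b.visits init K c) := by
  constructor
  · exact Finset.sum_nonneg fun k _ => by
      split_ifs
      · exact b.armMass_nonneg _ _
      · exact le_rfl
  · exact Finset.sum_le_sum fun k _ => by
      split_ifs
      · exact b.armMass_le_one _ _
      · exact le_rfl

omit [Fintype σ] in
theorem sum_plays [Fintype Λ] {K : ℕ} (c : Γ)
    (τ : Fin K → (Fin (H + 2) → σ) × (Fin (H + 1) → α)) :
    ∑ l, b.plays pol init c l τ = b.visits init K c := by
  simp only [plays, visits]
  rw [Finset.sum_comm]
  refine Finset.sum_congr rfl fun k _ => ?_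
  split_ifs
  · exact b.sum_armMass _
  · simp

/-- Making `l` the best arm in the context `c` increases the number of plays of `l` by a bounded
amount only. -/
theorem sum_runLaw_update_plays_le [DecidableEq Γ] {θ : Γ → Option Λ} {c : Γ} (hθ : θ c = none)
    (hg : ¬ b.good c) (hb : ¬ b.bad c) (l : Λ) (K : ℕ) {η : ℝ} (hη : 0 < η) :
    ∑ τ : Fin K → (Fin (H + 2) → σ) × (Fin (H + 1) → α),
        b.runLaw pol init (Function.update θ c (some l)) τ * b.plays pol init c l τ ≤
      (∑ τ : Fin K → (Fin (H + 2) → σ) × (Fin (H + 1) → α),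
        b.runLaw pol init θ τ * b.plays pol init c l τ) + b.visits init K c * (η +
          b.divergence * (∑ τ : Fin K → (Fin (H + 2) → σ) × (Fin (H + 1) → α),
            b.runLaw pol init θ τ * b.plays pol init c l τ) / η) := by
  classical
  set w : (Fin K → (Fin (H + 2) → σ) × (Fin (H + 1) → α)) → ℝ :=
    fun τ => ∏ k : Fin K, b.ratio c l (init k) ((τ k).2 0) ((τ k).1 1) with hw
  -- The learner's own choices are the same under both laws and cancel from the ratio.
  have hr : ∀ τ : Fin K → (Fin (H + 2) → σ) × (Fin (H + 1) → α),
      b.runLaw pol init (Function.update θ c (some l)) τ = b.runLaw pol init θ τ * w τ := by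
    intro τ
    simp only [runLaw, seqProb, b.pathProb_update hθ hg hb, Finset.prod_mul_distrib, hw]
  -- Chain rule for the divergence: the logarithm of the product splits over the episodes, and the
  -- tower property replaces each term by its mean given the past.
  have hlog : ∑ τ : Fin K → (Fin (H + 2) → σ) × (Fin (H + 1) → α),
      b.runLaw pol init θ τ * Real.log (w τ) =
      -b.divergence * ∑ τ : Fin K → (Fin (H + 2) → σ) × (Fin (H + 1) → α),
        b.runLaw pol init θ τ * b.plays pol init c l τ := by
    simp only [hw, Real.log_prod (fun k _ => (b.ratio_pos c l _ _ _).ne'), Finset.mul_sum, plays]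
    rw [Finset.sum_comm]
    conv_rhs => rw [Finset.sum_comm]
    refine Finset.sum_congr rfl fun k _ => ?_
    refine (sum_seqProb_tower (fun _ _ => sum_pathProb (b.sum_kernel θ) _ _) k
      (fun x => Real.log (b.ratio c l (init k) (x.2 0) (x.1 1)))).trans ?_
    refine Finset.sum_congr rfl fun τ _ => ?_
    rw [b.sum_pathProb_log_ratio hθ hg hb, mul_left_comm]
    rfl
  have h := sum_mul_likelihood_le (f := b.plays pol init c l) (b := b.visits init K c) hη
    (b.runLaw_nonneg pol init θ) (b.sum_runLaw pol init θ K)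
    (fun τ => Finset.prod_pos fun (k : Fin K) _ => b.ratio_pos c l (init k) ((τ k).2 0) ((τ k).1 1))
    (by
      have h1 := b.sum_runLaw pol init (Function.update θ c (some l)) K
      simpa only [hr] using h1) (b.plays_mem pol init c l)
  simp only [hr]
  refine h.trans_eq ?_
  rw [hlog, neg_mul, neg_neg]

end Learning

end Bandit

/-! ### Averaging over the best arms -/

theorem sum_sum_update {Γ Λ : Type u} [Fintype Γ] [DecidableEq Γ] [Fintype Λ] (c : Γ)
    (u : (Γ → Λ) → ℝ) :
    ∑ θ, ∑ l, u (Function.update θ c l) = Fintype.card Λ * ∑ θ, u θ := by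
  -- Exchanging `θ c` with `l` permutes the pairs `(θ, l)`.
  have hinv : Function.Involutive
      fun x : (Γ → Λ) × Λ => (Function.update x.1 c x.2, x.1 c) := fun x => by simp
  calc ∑ θ, ∑ l, u (Function.update θ c l)
      = ∑ x : (Γ → Λ) × Λ, u (hinv.toPerm _ x).1 := by rw [Fintype.sum_prod_type]; rfl
    _ = ∑ x : (Γ → Λ) × Λ, u x.1 := Equiv.sum_comp (hinv.toPerm _) fun x : (Γ → Λ) × Λ => u x.1
    _ = _ := by simp [Fintype.sum_prod_type, Finset.mul_sum]

open Classical in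
theorem sum_ite_eq_apply {Γ : Type u} [Fintype Γ] (x : Γ) (f : Γ → ℝ) :
    ∑ c, (if x = c then f c else 0) = f x :=
  (Fintype.sum_eq_single x fun _ h => if_neg h.symm).trans (if_pos rfl)

namespace Bandit

section Learning

variable {σ α Γ Λ : Type u} (b : Bandit σ α Γ Λ) [Fintype σ] [Fintype α] {H : ℕ}
  (pol : ∀ k : ℕ, (Fin k → (Fin (H + 2) → σ) × (Fin (H + 1) → α)) →
    Fin (H + 1) → σ → stdSimplex ℝ α) (init : ℕ → σ)

/-- The share `3/4` is `1/2 + 1/8 + 1/8`: at most `1 / |Λ| ≤ 1/2` for a blind guess, `η = 1/8`, and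
the divergence term, which `hv` bounds. -/
theorem sum_runLaw_plays_le [Fintype Γ] [DecidableEq Γ] [Fintype Λ]
    (hΛ : 2 ≤ Fintype.card Λ) {c : Γ} (hg : ¬ b.good c) (hb : ¬ b.bad c) (K : ℕ)
    (hv : 256 * b.ε ^ 2 * b.visits init K c ≤ Fintype.card Λ) :
    ∑ θ : Γ → Λ, ∑ τ : Fin K → (Fin (H + 2) → σ) × (Fin (H + 1) → α),
        b.runLaw pol init (fun c => some (θ c)) τ * b.plays pol init c (θ c) τ ≤
      Fintype.card (Γ → Λ) * (3 / 4 * b.visits init K c) := by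
  set v := b.visits init K c with hvdef
  set u : (Γ → Λ) → ℝ := fun θ => ∑ τ : Fin K → (Fin (H + 2) → σ) × (Fin (H + 1) → α),
    b.runLaw pol init (Function.update (fun c => some (θ c)) c none) τ *
      b.plays pol init c (θ c) τ with hu
  have hv0 : 0 ≤ v := Finset.sum_nonneg fun k _ => by split_ifs <;> norm_num
  have hle : ∀ θ : Γ → Λ, ∑ τ : Fin K → (Fin (H + 2) → σ) × (Fin (H + 1) → α),
      b.runLaw pol init (fun c => some (θ c)) τ * b.plays pol init c (θ c) τ ≤
        u θ + v * (1 / 8 + b.divergence * u θ / (1 / 8)) := by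
    intro θ
    have h := b.sum_runLaw_update_plays_le pol init
      (θ := Function.update (fun c => some (θ c)) c none) (Function.update_self ..) hg hb (θ c) K
      (η := 1 / 8) (by norm_num)
    rwa [Function.update_idem, Function.update_eq_self c (fun c => some (θ c))] at h
  -- The reference law forgets `θ c`, so summing over the values of `θ c` counts the plays of all
  -- arms under one law, which are all the visits.
  have hsum : Fintype.card Λ * ∑ θ, u θ = Fintype.card (Γ → Λ) * v := by
    rw [← sum_sum_update c u]
    have h : ∀ θ : Γ → Λ, ∑ l, u (Function.update θ c l) = v := by
      intro θ
      have h1 : ∀ l, Function.update (fun d => some (Function.update θ c l d)) c none =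
          Function.update (fun d => some (θ d)) c none := by
        intro l
        ext1 d
        by_cases hd : d = c
        · subst hd; simp
        · simp [hd]
      simp only [hu, h1, Function.update_self]
      rw [Finset.sum_comm]
      simp only [← Finset.mul_sum, b.sum_plays, ← hvdef]
      rw [← Finset.sum_mul, b.sum_runLaw, one_mul]
    simp [h]
  have hu0 : 0 ≤ ∑ θ, u θ := Finset.sum_nonneg fun θ _ => Finset.sum_nonneg fun τ _ =>
    mul_nonneg (b.runLaw_nonneg pol init _ τ) (b.plays_mem pol init c (θ c) τ).1
  have hΛ' : (2 : ℝ) ≤ Fintype.card Λ := by exact_mod_cast hΛ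
  refine (Finset.sum_le_sum fun θ _ => hle θ).trans ?_
  have e : ∑ θ, (u θ + v * (1 / 8 + b.divergence * u θ / (1 / 8))) =
      ∑ θ, u θ + Fintype.card (Γ → Λ) * v / 8 + 8 * (b.divergence * v) * ∑ θ, u θ := by
    simp only [mul_add, Finset.sum_add_distrib, Finset.mul_sum, Finset.sum_const,
      Finset.card_univ, nsmul_eq_mul]
    rw [add_assoc]
    congr 2
    · ring
    · exact Finset.sum_congr rfl fun _ _ => by ring
  rw [e]
  have h1 : b.divergence * v ≤ 4 * b.ε ^ 2 * v := mul_le_mul_of_nonneg_right b.divergence_le hv0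
  -- `8 * 4 ε² v = 256 ε² v / 8`, whence the constant 256 in `hv`.
  have h2 : 8 * (b.divergence * v) * ∑ θ, u θ ≤ (Fintype.card Λ / 8) * ∑ θ, u θ :=
    mul_le_mul_of_nonneg_right (by linarith) hu0
  have h3 : 2 * ∑ θ, u θ ≤ Fintype.card Λ * ∑ θ, u θ := mul_le_mul_of_nonneg_right hΛ' hu0
  linarith

omit [Fintype σ] in
theorem sum_playProb [Fintype Γ] [DecidableEq Γ] (θ : Γ → Λ) {K : ℕ}
    (τ : Fin K → (Fin (H + 2) → σ) × (Fin (H + 1) → α)) :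
    ∑ k, b.playProb pol init τ k (θ (b.ctx (init k))) =
      ∑ c, b.plays pol init c (θ c) τ := by
  simp only [plays]
  rw [Finset.sum_comm]
  refine Finset.sum_congr rfl fun k _ => ?_
  exact (sum_ite_eq_apply _ fun c => b.playProb pol init τ k (θ c)).symm

omit [Fintype σ] [Fintype α] in
theorem sum_visits [Fintype Γ] (K : ℕ) : ∑ c, b.visits init K c = K := by
  simp only [visits]
  rw [Finset.sum_comm]
  refine (Finset.sum_congr rfl fun k _ => sum_ite_eq_apply _ fun _ => (1 : ℝ)).trans ?_
  simp

/-- On average over the best arms, a learner misses the best arm in a quarter of the episodes. -/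
theorem sum_runLaw_playProb_le [Fintype Γ] [DecidableEq Γ] [Fintype Λ]
    (hΛ : 2 ≤ Fintype.card Λ) (K : ℕ) (hg : ∀ k < K, ¬ b.good (b.ctx (init k)))
    (hb : ∀ k < K, ¬ b.bad (b.ctx (init k)))
    (hv : ∀ c, 256 * b.ε ^ 2 * b.visits init K c ≤ Fintype.card Λ) :
    ∑ θ : Γ → Λ, ∑ τ : Fin K → (Fin (H + 2) → σ) × (Fin (H + 1) → α),
        b.runLaw pol init (fun c => some (θ c)) τ *
          ∑ k, b.playProb pol init τ k (θ (b.ctx (init k))) ≤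
      Fintype.card (Γ → Λ) * (3 / 4 * K) := by
  simp only [b.sum_playProb pol init, Finset.mul_sum]
  rw [← b.sum_visits init K, Finset.mul_sum, Finset.mul_sum]
  calc _ = ∑ c, ∑ θ : Γ → Λ, ∑ τ : Fin K → (Fin (H + 2) → σ) × (Fin (H + 1) → α),
        b.runLaw pol init (fun c => some (θ c)) τ * b.plays pol init c (θ c) τ := by
        exact (Finset.sum_congr rfl fun _ _ => Finset.sum_comm).trans Finset.sum_comm
    _ ≤ _ := Finset.sum_le_sum fun c _ => ?_
  -- No episode starts in a good or bad context, so both sides vanish there.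
  by_cases hc : b.good c ∨ b.bad c
  · have h0 : b.visits init K c = 0 := Finset.sum_eq_zero fun k _ => by
      rw [if_neg]
      rintro rfl
      exact hc.elim (hg k k.2) (hb k k.2)
    have h1 : ∀ l (τ : Fin K → (Fin (H + 2) → σ) × (Fin (H + 1) → α)),
        b.plays pol init c l τ = 0 := fun l τ => by
      have h := b.plays_mem pol init c l τ
      rw [h0] at h
      exact le_antisymm h.2 h.1
    simp [h0, h1]
  · push Not at hc
    exact b.sum_runLaw_plays_le pol init hΛ hc.1 hc.2 K (hv c)

end Learning

end Bandit

/-! ### Randomized learners -/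

namespace Bandit

section Learning

variable {σ α Γ Λ : Type u} (b : Bandit σ α Γ Λ) [Fintype σ] [Fintype α] {H : ℕ}
  {Ω : Type v} [MeasurableSpace Ω] (μ : MeasureTheory.Measure Ω)
  (pol : Ω → ∀ k : ℕ, (Fin k → (Fin (H + 2) → σ) × (Fin (H + 1) → α)) →
    Fin (H + 1) → σ → stdSimplex ℝ α) (init : ℕ → σ)

/-- The expected number of episodes in which the learner with seed `ω` misses the best arm. -/
def misses (θ : Γ → Λ) (K : ℕ) (ω : Ω) : ℝ :=
  ∑ τ : Fin K → (Fin (H + 2) → σ) × (Fin (H + 1) → α),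
    b.runLaw (pol ω) init (fun c => some (θ c)) τ *
      ∑ k, (1 - b.playProb (pol ω) init τ k (θ (b.ctx (init k))))

variable {pol}

theorem measurable_misses
    (hpol : ∀ k past h s a, Measurable fun ω => (pol ω k past h s).1 a)
    (θ : Γ → Λ) (K : ℕ) : Measurable (b.misses pol init θ K) := by
  unfold misses
  refine Finset.measurable_fun_sum _ fun τ _ => Measurable.mul ?_ ?_
  · unfold runLaw seqProb pathProb
    exact Finset.measurable_fun_prod _ fun k _ => Measurable.const_mul
      (Finset.measurable_fun_prod _ fun h _ => (hpol _ _ _ _ _).mul_const _) _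
  · unfold playProb armMass
    exact Finset.measurable_fun_sum _ fun k _ => Measurable.const_sub
      (Finset.measurable_fun_sum _ fun a _ => (hpol _ _ _ _ _).mul_const _) _

variable (pol)

omit [MeasurableSpace Ω] in
theorem misses_mem (θ : Γ → Λ) (K : ℕ) (ω : Ω) : b.misses pol init θ K ω ∈ Set.Icc (0 : ℝ) K := by
  constructor
  · exact Finset.sum_nonneg fun τ _ => mul_nonneg (b.runLaw_nonneg _ _ _ _)
      (Finset.sum_nonneg fun k _ => sub_nonneg.2 (b.armMass_le_one _ _))
  · calc b.misses pol init θ K ω ≤ ∑ τ : Fin K → (Fin (H + 2) → σ) × (Fin (H + 1) → α),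
          b.runLaw (pol ω) init (fun c => some (θ c)) τ * K := by
          refine Finset.sum_le_sum fun τ _ =>
            mul_le_mul_of_nonneg_left ?_ (b.runLaw_nonneg _ _ _ _)
          refine (Finset.sum_le_sum fun k _ =>
            sub_le_self (1 : ℝ) (b.armMass_nonneg _ _)).trans_eq ?_
          simp
      _ = K := by rw [← Finset.sum_mul, b.sum_runLaw, one_mul]

variable {pol}

/-- Some best arms make a randomized learner miss a quarter of the episodes. -/
theorem exists_integral_misses_ge [MeasureTheory.IsProbabilityMeasure μ] [Fintype Γ] [Fintype Λ]
    (hpol : ∀ k past h s a, Measurable fun ω => (pol ω k past h s).1 a)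
    (hΛ : 2 ≤ Fintype.card Λ) (K : ℕ) (hg : ∀ k < K, ¬ b.good (b.ctx (init k)))
    (hb : ∀ k < K, ¬ b.bad (b.ctx (init k)))
    (hv : ∀ c, 256 * b.ε ^ 2 * b.visits init K c ≤ Fintype.card Λ) :
    ∃ θ : Γ → Λ, (K : ℝ) / 4 ≤ ∫ ω, b.misses pol init θ K ω ∂μ := by
  classical
  have hne : Nonempty Λ := Fintype.card_pos_iff.1 (by omega)
  have hint : ∀ θ : Γ → Λ, MeasureTheory.Integrable (b.misses pol init θ K) μ := fun θ =>
    MeasureTheory.Integrable.of_mem_Icc 0 K (b.measurable_misses init hpol θ K).aemeasurable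
      (Filter.Eventually.of_forall (b.misses_mem pol init θ K))
  -- The hard `θ` must not depend on the seed, so the average over `θ` is kept until the seed is
  -- integrated out.
  have hpt : ∀ ω, ∑ _θ : Γ → Λ, (K : ℝ) / 4 ≤ ∑ θ : Γ → Λ, b.misses pol init θ K ω := by
    intro ω
    have h1 := b.sum_runLaw_playProb_le (pol ω) init hΛ K hg hb hv
    have h2 : ∑ θ : Γ → Λ, b.misses pol init θ K ω = Fintype.card (Γ → Λ) * K -
        ∑ θ : Γ → Λ, ∑ τ : Fin K → (Fin (H + 2) → σ) × (Fin (H + 1) → α),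
        b.runLaw (pol ω) init (fun c => some (θ c)) τ *
          ∑ k, b.playProb (pol ω) init τ k (θ (b.ctx (init k))) := by
      simp only [misses, Finset.sum_sub_distrib, mul_sub, ← Finset.sum_mul, b.sum_runLaw]
      simp
    rw [h2, Finset.sum_const, Finset.card_univ, nsmul_eq_mul]
    linarith
  have hsum : ∑ _θ : Γ → Λ, (K : ℝ) / 4 ≤ ∑ θ : Γ → Λ, ∫ ω, b.misses pol init θ K ω ∂μ := by
    rw [← MeasureTheory.integral_finsetSum _ fun θ _ => hint θ]
    refine le_trans ?_ (MeasureTheory.integral_mono (MeasureTheory.integrable_const _)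
      (MeasureTheory.integrable_finsetSum _ fun θ _ => hint θ) hpt)
    simp
  obtain ⟨θ, -, hθ⟩ := Finset.exists_le_of_sum_le Finset.univ_nonempty hsum
  exact ⟨θ, hθ⟩

end Learning

end Bandit

/-! ### Bandits as factored decision processes -/

section Scope

variable {m p : ℕ} {S : Fin m → Type u} {A : Fin p → Type u} {I : Finset (Fin m ⊕ Fin p)}

/-- The state components of a scope variable. -/
abbrev ScopeContext (S : Fin m → Type u) (I : Finset (Fin m ⊕ Fin p)) : Type u :=
  ∀ k : {k : Fin m // Sum.inl k ∈ I}, S k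

/-- The action components of a scope variable. -/
abbrev ScopeArm (A : Fin p → Type u) (I : Finset (Fin m ⊕ Fin p)) : Type u :=
  ∀ j : {j : Fin p // Sum.inr j ∈ I}, A j

/-- A scope variable consists of its state components and its action components. -/
def scopeSplit : ScopeSpace S A I ≃ ScopeContext S I × ScopeArm A I where
  toFun x := (fun k => x ⟨.inl k, k.2⟩, fun j => x ⟨.inr j, j.2⟩)
  invFun y
    | ⟨.inl k, h⟩ => y.1 ⟨k, h⟩
    | ⟨.inr j, h⟩ => y.2 ⟨j, h⟩
  left_inv x := by
    funext z
    rcases z with ⟨k | j, h⟩ <;> rfl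
  right_inv y := rfl

theorem scopeSize_eq [∀ i, Fintype (S i)] [∀ j, Fintype (A j)] :
    scopeSize S A I = Fintype.card (ScopeContext S I) * Fintype.card (ScopeArm A I) := by
  rw [scopeSize, Nat.card_congr scopeSplit, Nat.card_prod, Nat.card_eq_fintype_card,
    Nat.card_eq_fintype_card]

end Scope

/-- Replace a forbidden coordinate by a third value `t`; a tag in `Fin 3` records what was replaced,
which makes the map injective. -/
theorem card_pi_le_three_mul {κ : Type*} [Fintype κ] [DecidableEq κ] {β : κ → Type*}
    [∀ k, Fintype (β k)] (k₀ : κ) {x y : β k₀} (h : 3 ≤ Fintype.card (β k₀))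
    [Fintype {f : ∀ k, β k // f k₀ ≠ x ∧ f k₀ ≠ y}] :
    Fintype.card (∀ k, β k) ≤ 3 * Fintype.card {f : ∀ k, β k // f k₀ ≠ x ∧ f k₀ ≠ y} := by
  classical
  obtain ⟨t, ht⟩ : ∃ t, t ∉ ({x, y} : Finset (β k₀)) := by
    by_contra! hc
    have h1 : Fintype.card (β k₀) ≤ ({x, y} : Finset (β k₀)).card :=
      Finset.card_le_card fun t _ => hc t
    have h2 : ({x, y} : Finset (β k₀)).card ≤ 2 := Finset.card_le_two
    omega
  simp only [Finset.mem_insert, Finset.mem_singleton, not_or] at ht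
  let F : (∀ k, β k) → Fin 3 × {f : ∀ k, β k // f k₀ ≠ x ∧ f k₀ ≠ y} := fun f =>
    if hx : f k₀ = x then (0, ⟨Function.update f k₀ t, by simpa using ht⟩)
    else if hy : f k₀ = y then (1, ⟨Function.update f k₀ t, by simpa using ht⟩)
    else (2, ⟨f, hx, hy⟩)
  have hup : ∀ f g : ∀ k, β k, f k₀ = g k₀ → Function.update f k₀ t = Function.update g k₀ t →
      f = g := by
    intro f g h0 h1
    funext k
    by_cases hk : k = k₀
    · subst hk; exact h0
    · simpa [hk] using congrFun h1 k
  have hF : Function.Injective F := by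
    intro f g hfg
    simp only [F] at hfg
    split_ifs at hfg with h1 h2 h3 h4 h5 h6 h7 h8 <;>
      simp only [Prod.mk.injEq, Subtype.mk.injEq, true_and] at hfg <;>
      first
        | exact absurd hfg.1 (by decide)
        | exact hup f g (by simp_all) hfg
        | exact hfg
  simpa using Fintype.card_le_of_injective F hF

/-! ### The factored process of a bandit -/

section ScopeBandit

variable {m p : ℕ} {S : Fin m → Type u} {A : Fin p → Type u}

/-- The bandit whose contexts and arms are the state and action components of the scope `I`. The
component `i` of the state is good if it equals `d i`, and bad if it equals `d'`. -/
def scopeBandit (A : Fin p → Type u) {I : Finset (Fin m ⊕ Fin p)} {i : Fin m} (hi : Sum.inl i ∈ I)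
    (d : State S) {d' : S i} (hd : d' ≠ d i) {ε : ℝ} (hε : 0 < ε) (hε' : 4 * ε ≤ 1) :
    Bandit (State S) (Action A) (ScopeContext S I) (ScopeArm A I) where
  ctx s := fun k => s k
  arm a := fun j => a j
  good c := c ⟨i, hi⟩ = d i
  bad c := c ⟨i, hi⟩ = d'
  G := d
  B := Function.update d i d'
  ε := ε
  good_G := rfl
  bad_B := by simp
  not_good_B := by simpa using hd
  eps_pos := hε
  four_eps_le := hε'

variable [∀ i, Fintype (S i)] {scope : Fin m → Finset (Fin m ⊕ Fin p)}

open Classical in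
/-- The factored decision process in which the component `i` follows a bandit and the other
components move to `d`. The reward is `1` if the component `i` equals `d i`. -/
def banditFMDP {i : Fin m} (hi : Sum.inl i ∈ scope i)
    (d : State S) {d' : S i} (hd : d' ≠ d i) {ε : ℝ} (hε : 0 < ε) (hε' : 4 * ε ≤ 1)
    (θ : ScopeContext S (scope i) → Option (ScopeArm A (scope i))) : FMDP S A scope where
  reward s _ := if s i = d i then 1 else 0
  reward_mem s _ := by split_ifs <;> simp
  transComp k x t :=
    -- `twoPoint` serves here as a mere distribution on `S k`, with dummy state and action. For `k ≠
    -- i` it is the point mass at `d k`.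
    twoPoint (d k) (Function.update d i d' k)
      (fun (_ : S k) (_ : PUnit.{u + 1}) => Function.update (β := fun k => ScopeSpace S A (scope k) → ℝ)
        (fun _ _ => 1) i (fun x => (scopeBandit A hi d hd hε hε').succProb θ (scopeSplit x).1
          (scopeSplit x).2) k x) (d k) PUnit.unit t
  transComp_mem k x := by
    refine ⟨fun t => twoPoint_nonneg (fun _ _ => ?_) _ _ t, sum_twoPoint _ _⟩
    by_cases hk : k = i
    · subst hk
      rw [Function.update_self]
      exact Bandit.succProb_mem _ _ _ _
    · rw [Function.update_of_ne hk]
      simp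

/-- Since the other components move to `d` surely, the product of the component laws lives on two
states that differ at most in component `i`. -/
theorem banditFMDP_trans {i : Fin m} (hi : Sum.inl i ∈ scope i)
    (d : State S) {d' : S i} (hd : d' ≠ d i) {ε : ℝ} (hε : 0 < ε) (hε' : 4 * ε ≤ 1)
    (θ : ScopeContext S (scope i) → Option (ScopeArm A (scope i))) :
    (banditFMDP hi d hd hε hε' θ).trans = (scopeBandit A hi d hd hε hε').kernel θ := by
  classical
  funext s a s'
  rw [FMDP.trans, ← Finset.mul_prod_erase _ _ (Finset.mem_univ i)]
  have h : ∏ k ∈ Finset.univ.erase i, (banditFMDP hi d hd hε hε' θ).transComp k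
      (scopeVar (scope k) s a) (s' k) = ∏ k ∈ Finset.univ.erase i, if s' k = d k then 1 else 0 := by
    refine Finset.prod_congr rfl fun k hk => ?_
    have hk' := Finset.ne_of_mem_erase hk
    simp only [banditFMDP, twoPoint, Function.update_of_ne hk', sub_self, zero_mul, add_zero,
      one_mul]
  rw [h, Finset.prod_ite_zero, Finset.prod_const_one]
  simp only [banditFMDP, twoPoint, Function.update_self, Bandit.kernel]
  have hsplit : (scopeSplit (scopeVar (scope i) s a)) =
      ((scopeBandit A hi d hd hε hε').ctx s, (scopeBandit A hi d hd hε hε').arm a) := rfl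
  rw [hsplit]
  have hG : (scopeBandit A hi d hd hε hε').G = d := rfl
  have hB : (scopeBandit A hi d hd hε hε').B = Function.update d i d' := rfl
  rw [hG, hB]
  by_cases hall : ∀ k ∈ Finset.univ.erase i, s' k = d k
  · have h1 : s' = d ↔ s' i = d i := by
      refine ⟨fun h => h ▸ rfl, fun h => funext fun k => ?_⟩
      by_cases hk : k = i
      · subst hk; exact h
      · exact hall k (by simpa using hk)
    have h2 : s' = Function.update d i d' ↔ s' i = d' := by
      refine ⟨fun h => by simp [h], fun h => funext fun k => ?_⟩
      by_cases hk : k = i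
      · subst hk; simpa using h
      · simpa [hk] using hall k (by simpa using hk)
    rw [if_pos hall, mul_one]
    simp only [h1, h2]
  · have h1 : s' ≠ d := fun h => hall fun k _ => h ▸ rfl
    have h2 : s' ≠ Function.update d i d' := fun h => hall fun k hk => by
      rw [h, Function.update_of_ne (Finset.ne_of_mem_erase hk)]
    rw [if_neg hall, if_neg h1, if_neg h2]
    ring

variable [∀ j, Fintype (A j)]

theorem FMDP.trajProb_eq_pathProb (M : FMDP S A scope) {H : ℕ} (π : Policy S A H) (s : State S)
    (τ : Trajectory S A H) : M.trajProb π s τ = pathProb M.trans π s τ := by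
  unfold FMDP.trajProb pathProb
  congr

theorem FMDP.value_eq_pathValue (M : FMDP S A scope) {H : ℕ} (π : Policy S A H) (s : State S) :
    M.value π s = pathValue M.trans M.reward π s := by
  unfold FMDP.value pathValue
  simp only [M.trajProb_eq_pathProb]

theorem banditFMDP_value {i : Fin m} (hi : Sum.inl i ∈ scope i)
    (d : State S) {d' : S i} (hd : d' ≠ d i) {ε : ℝ} (hε : 0 < ε) (hε' : 4 * ε ≤ 1)
    (θ : ScopeContext S (scope i) → ScopeArm A (scope i)) {H : ℕ} (π : Policy S A (H + 1))
    {s : State S} (hs : s i ≠ d i) (hs' : s i ≠ d') :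
    (banditFMDP hi d hd hε hε' fun c => some (θ c)).value π s =
      H * (1 / 2 + ε * (scopeBandit A hi d hd hε hε').armMass (π 0 s)
        (θ ((scopeBandit A hi d hd hε hε').ctx s))) := by
  rw [FMDP.value_eq_pathValue, banditFMDP_trans]
  refine Bandit.pathValue_kernel _ (fun a => ?_) (fun a => ?_) (fun a => ?_) hs hs' θ π
  · exact if_pos rfl
  · refine if_neg ?_
    change Function.update d i d' i ≠ d i
    simpa using hd
  · exact if_neg hs

theorem banditFMDP_optValue [∀ j, Nonempty (A j)] {i : Fin m} (hi : Sum.inl i ∈ scope i)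
    (d : State S) {d' : S i} (hd : d' ≠ d i) {ε : ℝ} (hε : 0 < ε) (hε' : 4 * ε ≤ 1)
    (θ : ScopeContext S (scope i) → ScopeArm A (scope i)) (H : ℕ)
    {s : State S} (hs : s i ≠ d i) (hs' : s i ≠ d') :
    (banditFMDP hi d hd hε hε' fun c => some (θ c)).optValue (H + 1) s = H * (1 / 2 + ε) := by
  classical
  set b := scopeBandit A hi d hd hε hε' with hb
  -- The optimum is attained by always playing an action that extends the best arm; components
  -- outside the scope are irrelevant.
  let a : Action A := fun j => if h : Sum.inr j ∈ scope i then θ (b.ctx s) ⟨j, h⟩ else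
    Classical.arbitrary _
  have ha : b.arm a = θ (b.ctx s) := by
    funext j
    exact dif_pos j.2
  let π : Policy S A (H + 1) := fun _ _ => ⟨Pi.single a 1, single_mem_stdSimplex ℝ a⟩
  have hle : ∀ π : Policy S A (H + 1),
      (banditFMDP hi d hd hε hε' fun c => some (θ c)).value π s ≤ H * (1 / 2 + ε) := by
    intro π
    rw [banditFMDP_value hi d hd hε hε' θ π hs hs']
    have h1 := b.armMass_le_one (π 0 s) (θ (b.ctx s))
    have h2 : ε * b.armMass (π 0 s) (θ (b.ctx s)) ≤ ε := mul_le_of_le_one_right hε.le h1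
    exact mul_le_mul_of_nonneg_left (by linarith) (Nat.cast_nonneg H)
  have hπ : (banditFMDP hi d hd hε hε' fun c => some (θ c)).value π s = H * (1 / 2 + ε) := by
    rw [banditFMDP_value hi d hd hε hε' θ π hs hs', ← hb]
    have h1 : b.armMass (π 0 s) (θ (b.ctx s)) = 1 := by
      simp only [Bandit.armMass, π]
      rw [Finset.sum_eq_single a (fun a' _ h => by simp [h]) (by simp)]
      simp [ha]
    rw [h1, mul_one]
  have : Nonempty (Policy S A (H + 1)) := ⟨π⟩
  exact le_antisymm (ciSup_le hle) (hπ ▸ le_ciSup (f := fun π : Policy S A (H + 1) =>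
    (banditFMDP hi d hd hε hε' fun c => some (θ c)).value π s)
      ⟨_, Set.forall_mem_range.2 hle⟩ π)

/-- Optimal value minus value in an episode is `H ε` times the probability of not playing the best
arm. -/
theorem banditFMDP_expectedRegret [∀ j, Nonempty (A j)] {i : Fin m} (hi : Sum.inl i ∈ scope i)
    (d : State S) {d' : S i} (hd : d' ≠ d i) {ε : ℝ} (hε : 0 < ε) (hε' : 4 * ε ≤ 1)
    (θ : ScopeContext S (scope i) → ScopeArm A (scope i)) {H : ℕ}
    {Ω : Type v} [MeasurableSpace Ω] (μ : MeasureTheory.Measure Ω)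
    (alg : Algorithm S A (H + 1) Ω) (K : ℕ) (init : ℕ → State S)
    (hs : ∀ k, init k i ≠ d i) (hs' : ∀ k, init k i ≠ d') :
    expectedRegret (banditFMDP hi d hd hε hε' fun c => some (θ c)) alg μ
        (fun k : Fin K => init k) =
      H * ε * ∫ ω, (scopeBandit A hi d hd hε hε').misses
        (fun ω k past => alg.policy (banditFMDP hi d hd hε hε' fun c => some (θ c)).reward ω k past
          (init k)) init θ K ω ∂μ := by
  rw [← MeasureTheory.integral_const_mul, expectedRegret]
  congr 1
  funext ω
  rw [Bandit.misses, Finset.mul_sum]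
  refine Finset.sum_congr rfl fun τ _ => ?_
  have h1 : runProb (banditFMDP hi d hd hε hε' fun c => some (θ c)) alg ω
      (fun k : Fin K => init k) τ = (scopeBandit A hi d hd hε hε').runLaw
        (fun k past => alg.policy (banditFMDP hi d hd hε hε' fun c => some (θ c)).reward ω k past
          (init k)) init (fun c => some (θ c)) τ := by
    rw [Bandit.runLaw, ← banditFMDP_trans]
    unfold runProb
    simp only [FMDP.trajProb_eq_pathProb]
    rfl
  rw [h1, mul_left_comm]
  congr 1
  rw [regret, Finset.mul_sum]
  refine Finset.sum_congr rfl fun k _ => ?_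
  rw [banditFMDP_optValue hi d hd hε hε' θ H (hs k) (hs' k),
    banditFMDP_value hi d hd hε hε' θ _ (hs k) (hs' k)]
  have h2 : (scopeBandit A hi d hd hε hε').playProb
      (fun k past => alg.policy (banditFMDP hi d hd hε hε' fun c => some (θ c)).reward ω k past
          (init k)) init τ k (θ ((scopeBandit A hi d hd hε hε').ctx (init k))) =
      (scopeBandit A hi d hd hε hε').armMass
        (alg.policyAt (banditFMDP hi d hd hε hε' fun c => some (θ c)).reward ω
          (fun k : Fin K => init k) τ k 0 (init k))
            (θ ((scopeBandit A hi d hd hε hε').ctx (init k))) := rfl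
  rw [h2]
  ring

end ScopeBandit

/-! ### Choice of the bias and of the initial states -/

/-- In a cyclic sequence every value is taken about equally often. -/
theorem card_filter_mod_le {C K : ℕ} (c : ℕ) :
    (Finset.univ.filter fun k : Fin K => (k : ℕ) % C = c).card ≤ K / C + 1 := by
  rw [← Finset.card_range (K / C + 1)]
  refine Finset.card_le_card_of_injOn (fun k => (k : ℕ) / C) (fun k _ => ?_) fun k hk l hl h => ?_
  · have := Nat.div_le_div_right (c := C) k.is_lt.le
    simp only [Finset.coe_range, Set.mem_Iio]
    omega
  · simp only [Finset.coe_filter, Finset.mem_univ, true_and, Set.mem_ofPred_eq] at hk hl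
    have h1 := Nat.div_add_mod (k : ℕ) C
    have h2 := Nat.div_add_mod (l : ℕ) C
    simp only at h
    rw [h] at h1
    exact Fin.ext (by omega)

/-- The lower bound for one component whose scope size is at most the number of episodes. -/
theorem exists_le_expectedRegret {m p : ℕ} {S : Fin m → Type u} {A : Fin p → Type u}
    [∀ i, Fintype (S i)] [∀ j, Fintype (A j)] [∀ j, Nonempty (A j)]
    {scope : Fin m → Finset (Fin m ⊕ Fin p)} {H K : ℕ} (hS : ∀ i, 3 ≤ Fintype.card (S i))
    {i : Fin m} (hi : Sum.inl i ∈ scope i) (hA : ∃ j, Sum.inr j ∈ scope i ∧ 2 ≤ Fintype.card (A j))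
    (hK : scopeSize S A (scope i) ≤ K) {Ω : Type v} [MeasurableSpace Ω]
    (μ : MeasureTheory.Measure Ω) [MeasureTheory.IsProbabilityMeasure μ]
    (alg : Algorithm S A (H + 1) Ω) :
    ∃ (M : FMDP S A scope) (init : Fin K → State S),
      H * √(scopeSize S A (scope i) * K) / 160 ≤ expectedRegret M alg μ init := by
  classical
  have hSne : ∀ k, Nonempty (S k) := fun k => Fintype.card_pos_iff.1 (by have := hS k; omega)
  let d : State S := fun k => Classical.arbitrary _
  obtain ⟨d', hd⟩ : ∃ d', d' ≠ d i := by
    have : Nontrivial (S i) := Fintype.one_lt_card_iff_nontrivial.1 (by have := hS i; omega)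
    exact exists_ne _
  let Γ := ScopeContext S (scope i)
  let Λ := ScopeArm A (scope i)
  let Γ' := {c : Γ // c ⟨i, hi⟩ ≠ d i ∧ c ⟨i, hi⟩ ≠ d'}
  have hX : scopeSize S A (scope i) = Fintype.card Γ * Fintype.card Λ := scopeSize_eq
  have hΓ : Fintype.card Γ ≤ 3 * Fintype.card Γ' :=
    card_pi_le_three_mul (β := fun k : {k : Fin m // Sum.inl k ∈ scope i} => S k) ⟨i, hi⟩ (hS i)
  have hΓ' : Fintype.card Γ' ≤ Fintype.card Γ := Fintype.card_subtype_le _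
  have hΓ0 : 0 < Fintype.card Γ := Fintype.card_pos
  have hΛ : 2 ≤ Fintype.card Λ := by
    obtain ⟨j, hj, hj2⟩ := hA
    refine hj2.trans (Fintype.card_le_of_surjective (fun l : Λ => l ⟨j, hj⟩) fun x => ?_)
    exact ⟨Function.update (fun _ => Classical.arbitrary _) ⟨j, hj⟩ x, by simp⟩
  set X := scopeSize S A (scope i) with hXdef
  set C := Fintype.card Γ' with hC
  have hC0 : 0 < C := by omega
  have hX0 : 0 < X := by rw [hX]; positivity
  have hK0 : 0 < K := by omega
  have hCK : C ≤ K := by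
    have : Fintype.card Γ * 1 ≤ Fintype.card Γ * Fintype.card Λ := Nat.mul_le_mul_left _ (by omega)
    omega
  have hXr : (0 : ℝ) < X := by exact_mod_cast hX0
  have hKr : (0 : ℝ) < K := by exact_mod_cast hK0
  have hCr : (0 : ℝ) < C := by exact_mod_cast hC0
  have hXK : (X : ℝ) / K ≤ 1 := (div_le_one hKr).2 (by exact_mod_cast hK)
  -- `X ≤ K` gives `4 ε ≤ 1`. The factor 40 is large enough for `hv`: `256 * 2 * 3 / 40² = 24/25`.
  set ε : ℝ := √(X / K) / 40 with hεdef
  have hε : 0 < ε := by positivity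
  have hε' : 4 * ε ≤ 1 := by
    have : √((X : ℝ) / K) ≤ 1 := Real.sqrt_le_one.2 hXK
    linarith
  have hε2 : ε ^ 2 = X / K / 1600 := by
    rw [hεdef, div_pow, Real.sq_sqrt (by positivity)]
    norm_num
  let e : Γ' ≃ Fin C := Fintype.equivFin Γ'
  let start : Γ' → State S := fun c k =>
    if h : Sum.inl k ∈ scope i then c.1 ⟨k, h⟩ else d k
  -- The admissible contexts take turns, so each is visited at most `K / C + 1 ≤ 2 K / C` times.
  let init : ℕ → State S := fun k => start (e.symm ⟨k % C, Nat.mod_lt k hC0⟩)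
  have hstart : ∀ c, start c i = c.1 ⟨i, hi⟩ := fun c => dif_pos hi
  have hs : ∀ k, init k i ≠ d i := fun k => by
    simp only [init, hstart]
    exact (e.symm _).2.1
  have hs' : ∀ k, init k i ≠ d' := fun k => by
    simp only [init, hstart]
    exact (e.symm _).2.2
  set b := scopeBandit A hi d hd hε hε' with hb
  have hctx : ∀ k, b.ctx (init k) = (e.symm ⟨k % C, Nat.mod_lt k hC0⟩).1 := fun k =>
    funext fun z => dif_pos z.2
  have hvisits : ∀ c, b.visits init K c ≤ 2 * K / C := by
    intro c
    have h1 : b.visits init K c ≤ (K / C + 1 : ℕ) := by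
      simp only [Bandit.visits, hctx, Finset.sum_boole]
      rw [Nat.cast_le]
      by_cases hc : c ⟨i, hi⟩ ≠ d i ∧ c ⟨i, hi⟩ ≠ d'
      · refine le_trans (Finset.card_le_card fun k hk => ?_)
          (card_filter_mod_le (C := C) (e ⟨c, hc⟩ : ℕ))
        simp only [Finset.mem_filter, Finset.mem_univ, true_and] at hk ⊢
        have h2 : e.symm ⟨k % C, Nat.mod_lt k hC0⟩ = ⟨c, hc⟩ := Subtype.ext hk
        rw [← h2, Equiv.apply_symm_apply]
      · rw [Finset.filter_false_of_mem]
        · simp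
        · rintro k - rfl
          exact hc (e.symm _).2
    have h3 : ((K / C : ℕ) : ℝ) ≤ K / C := Nat.cast_div_le
    have h4 : (1 : ℝ) ≤ K / C := (one_le_div hCr).2 (by exact_mod_cast hCK)
    push_cast at h1
    have h5 : (2 : ℝ) * K / C = K / C + K / C := by ring
    linarith
  have hv : ∀ c, 256 * b.ε ^ 2 * b.visits init K c ≤ Fintype.card Λ := by
    intro c
    have h1 : (X : ℝ) ≤ 3 * C * Fintype.card Λ := by
      rw [hX]
      exact_mod_cast Nat.mul_le_mul_right _ hΓ
    have h2 : b.ε = ε := rfl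
    calc 256 * b.ε ^ 2 * b.visits init K c ≤ 256 * b.ε ^ 2 * (2 * K / C) :=
          mul_le_mul_of_nonneg_left (hvisits c) (by positivity)
      _ = 8 / 25 * (X / C) := by
          rw [h2, hε2]
          field_simp
          norm_num
      _ ≤ 8 / 25 * (3 * Fintype.card Λ) := by
          gcongr
          rw [div_le_iff₀ hCr]
          linarith
      _ ≤ Fintype.card Λ := by
          have : (0 : ℝ) ≤ Fintype.card Λ := Nat.cast_nonneg _
          linarith
  obtain ⟨θ, hθ⟩ := b.exists_integral_misses_ge μ (H := H)
    -- The reward is written without `θ`: the learner is fixed before `θ` is chosen.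
    (pol := fun ω k past => alg.policy (fun s _ => if s i = d i then 1 else 0) ω k past (init k))
    init (fun k past h s a => alg.measurable_policy _ k past (init k) h s a) hΛ K
    (fun k _ => hs k) (fun k _ => hs' k) hv
  refine ⟨banditFMDP hi d hd hε hε' fun c => some (θ c), fun k => init k, ?_⟩
  rw [banditFMDP_expectedRegret hi d hd hε hε' θ μ alg K init hs hs']
  have h1 : ε * K = √(X * K) / 40 := by
    have h2 : √((X : ℝ) * K) = √(X / K) * K := by
      rw [show (X : ℝ) * K = X / K * K ^ 2 by field_simp, Real.sqrt_mul (by positivity),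
        Real.sqrt_sq hKr.le]
    rw [h2, hεdef]
    ring
  calc H * √(X * K) / 160 = H * ε * (K / 4) := by
        linear_combination -(H / 4 : ℝ) * h1
    _ ≤ _ := mul_le_mul_of_nonneg_left hθ (by positivity)

end FactoredMDP

end

theorem theorem4 :
    ∃ c : ℝ, 0 < c ∧
      ∀ (m p : ℕ) (S : Fin m → Type u) (A : Fin p → Type u)
        [∀ i, Fintype (S i)] [∀ j, Fintype (A j)] [∀ j, Nonempty (A j)]
        (scope : Fin m → Finset (Fin m ⊕ Fin p)) (H K : ℕ),
        (∀ i, 3 ≤ Fintype.card (S i)) →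
        (∀ i, Sum.inl i ∈ scope i) →
        (∀ i, ∃ j, Sum.inr j ∈ scope i ∧ 2 ≤ Fintype.card (A j)) →
        2 ≤ H →
        FactoredMDP.maxScopeSize S A scope ≤ K →
        ∀ (Ω : Type v) [MeasurableSpace Ω] (μ : MeasureTheory.Measure Ω)
          [MeasureTheory.IsProbabilityMeasure μ] (alg : FactoredMDP.Algorithm S A H Ω),
          ∃ (M : FactoredMDP.FMDP S A scope) (init : Fin K → FactoredMDP.State S),
            c * √((H : ℝ) * (FactoredMDP.maxScopeSize S A scope : ℝ) * ((K : ℝ) * (H : ℝ)))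
              ≤ FactoredMDP.expectedRegret M alg μ init := by
  refine ⟨1 / 320, by norm_num, ?_⟩
  intro m p S A _ _ _ scope H K hS hscope hA hH hK Ω _ μ _ alg
  -- Without state components the supremum of the scope sizes is 0, and so is the bound.
  rcases isEmpty_or_nonempty (Fin m) with hm | hm
  · refine ⟨⟨fun _ _ => 0, fun _ _ => by simp, fun i => hm.elim i, fun i => hm.elim i⟩,
      fun _ i => hm.elim i, ?_⟩
    simp [FactoredMDP.maxScopeSize, FactoredMDP.expectedRegret, FactoredMDP.regret,
      FactoredMDP.FMDP.optValue, FactoredMDP.FMDP.value]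
  · obtain ⟨i, -, hi⟩ := Finset.exists_mem_eq_sup Finset.univ Finset.univ_nonempty
      fun i => FactoredMDP.scopeSize S A (scope i)
    obtain ⟨H, rfl⟩ : ∃ H', H = H' + 1 := ⟨H - 1, by omega⟩
    have hX : FactoredMDP.maxScopeSize S A scope = FactoredMDP.scopeSize S A (scope i) := hi
    rw [hX] at hK ⊢
    obtain ⟨M, init, h⟩ := FactoredMDP.exists_le_expectedRegret hS (hscope i) (hA i) hK μ alg
    refine ⟨M, init, le_trans ?_ h⟩
    -- The horizon is now `H + 1`, and `H + 1 ≤ 2 H` turns the constant `1/160` into `1/320`.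
    have h1 : (1 : ℝ) ≤ H := by exact_mod_cast (by omega : 1 ≤ H)
    have h2 : √(((H + 1 : ℕ) : ℝ) * (FactoredMDP.scopeSize S A (scope i) : ℝ) *
        ((K : ℝ) * ((H + 1 : ℕ) : ℝ))) =
        (H + 1) * √(FactoredMDP.scopeSize S A (scope i) * K) := by
      rw [← Real.sqrt_sq (by positivity : (0 : ℝ) ≤ H + 1), ← Real.sqrt_mul (by positivity)]
      congr 1
      push_cast
      ring
    rw [h2]
    have h3 := Real.sqrt_nonneg ((FactoredMDP.scopeSize S A (scope i) : ℝ) * K)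
    nlinarith
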